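/- For integers $P,Q,R>2$ that are coprime in pairs, let $$Q_{\{P,Q,R\}}(x)=\frac{(x^{PQR}-1)(x^{P}-1)(x^{Q}-1)(x^{R}-1)}{(x^{PQ}-1)(x^{QR}-1)(x^{RP}-1)(x-1)},$$ which is a polynomial with integer coefficients, and let $\mathcal A_{\{P,Q,R\}}\subset\mathbb Z$ be the set of its coefficients (from the constant to the leading coefficient). For distinct primes $p,q,r$ and exponents $a,b,c$ with $p^a,q^b,r^c>2$, the unitary cyclotomic polynomial of order three is $\Phi^*_{p^aq^br^c}=Q_{\{p^a,q^b,r^c\}}$. Corollary. For every triple of distinct primes $p,q,r$, $$\bigcup_{a,b,c}\mathcal A_{\{p^a,q^b,r^c\}}=\mathbb Z,$$ where the union is over all natural exponents $a,b,c$ with $p^a,q^b,r^c>2$. In particular, the coefficients in every such family are unbounded: for every $M$ there are such exponents $a,b,c$ for which $\Phi^*_{p^aq^br^c}$ has a coefficient $n$ with $|n|>M$. -/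

import Mathlib

open Polynomial

/-- The numerator `(x^(PQR) - 1)(x^P - 1)(x^Q - 1)(x^R - 1)`. -/
noncomputable def ternaryNum (P Q R : ℕ) : ℤ[X] :=
  (X ^ (P * Q * R) - 1) * (X ^ P - 1) * (X ^ Q - 1) * (X ^ R - 1)

/-- The denominator `(x^(PQ) - 1)(x^(QR) - 1)(x^(RP) - 1)(x - 1)`. -/
noncomputable def ternaryDen (P Q R : ℕ) : ℤ[X] :=
  (X ^ (P * Q) - 1) * (X ^ (Q * R) - 1) * (X ^ (R * P) - 1) * (X - 1)

/-- The ternary inclusion-exclusion polynomial: the quotient of `ternaryNum P Q R` by the monic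
polynomial `ternaryDen P Q R`. The division is exact when `P`, `Q`, `R` are positive and coprime
in pairs, see `inclusionExclusionPoly_mul_den`. -/
noncomputable def inclusionExclusionPoly (P Q R : ℕ) : ℤ[X] :=
  ternaryNum P Q R /ₘ ternaryDen P Q R

/-- The unitary cyclotomic polynomial of order three with index `p ^ a * q ^ b * r ^ c`. -/
noncomputable def unitaryCyclotomic (p q r a b c : ℕ) : ℤ[X] :=
  inclusionExclusionPoly (p ^ a) (q ^ b) (r ^ c)

/-- The set of coefficients of an integer polynomial, from the constant to the leading one
(the zeros beyond the degree are not counted). -/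
def coeffSet (f : ℤ[X]) : Set ℤ :=
  {n | ∃ m : ℕ, m ≤ f.natDegree ∧ f.coeff m = n}

theorem ternaryDen_monic {P Q R : ℕ} (hP : 0 < P) (hQ : 0 < Q) (hR : 0 < R) :
    (ternaryDen P Q R).Monic := by
  have h : ∀ n : ℕ, 0 < n → (X ^ n - 1 : ℤ[X]).Monic := fun n hn => by
    simpa using monic_X_pow_sub_C (1 : ℤ) hn.ne'
  have h1 : (X - 1 : ℤ[X]).Monic := by simpa using monic_X_sub_C (1 : ℤ)
  exact (((h _ (Nat.mul_pos hP hQ)).mul (h _ (Nat.mul_pos hQ hR))).mul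
    (h _ (Nat.mul_pos hR hP))).mul h1

theorem ternaryDen_dvd_ternaryNum {P Q R : ℕ} (hP : 0 < P) (hQ : 0 < Q) (hR : 0 < R)
    (hPQ : P.Coprime Q) (hQR : Q.Coprime R) (hRP : R.Coprime P) :
    ternaryDen P Q R ∣ ternaryNum P Q R := by
  have key : ∀ n : ℕ, 0 < n →
      (X ^ n - 1 : ℤ[X]) = (n.divisors.val.map fun d => cyclotomic d ℤ).prod := fun n hn =>
    (prod_cyclotomic_eq_X_pow_sub_one hn ℤ).symm
  have key1 : (X - 1 : ℤ[X]) = ((Nat.divisors 1).val.map fun d => cyclotomic d ℤ).prod := by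
    simpa only [pow_one] using key 1 one_pos
  have hPQ' := Nat.mul_pos hP hQ
  have hQR' := Nat.mul_pos hQ hR
  have hRP' := Nat.mul_pos hR hP
  have hPQR' := Nat.mul_pos hPQ' hR
  unfold ternaryDen ternaryNum
  rw [key _ hPQ', key _ hQR', key _ hRP', key1, key _ hPQR', key _ hP, key _ hQ, key _ hR]
  simp only [← Multiset.prod_add, ← Multiset.map_add]
  apply Multiset.prod_dvd_prod_of_le
  apply Multiset.map_le_map
  rw [Multiset.le_iff_count]
  intro d
  simp only [Multiset.count_add, Multiset.count_eq_of_nodup (Finset.nodup _), Finset.mem_val,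
    Nat.mem_divisors, hP.ne', hQ.ne', hR.ne', hPQ'.ne', hQR'.ne', hRP'.ne', hPQR'.ne', ne_eq,
    not_false_eq_true, and_true, Nat.dvd_one, one_ne_zero]
  have d1 : d = 1 → d ∣ P ∧ d ∣ Q ∧ d ∣ R := by rintro rfl; simp
  have a1 : d ∣ P → d ∣ Q → d = 1 := fun h h' => Nat.eq_one_of_dvd_coprimes hPQ h h'
  have a2 : d ∣ Q → d ∣ R → d = 1 := fun h h' => Nat.eq_one_of_dvd_coprimes hQR h h'
  have a3 : d ∣ R → d ∣ P → d = 1 := fun h h' => Nat.eq_one_of_dvd_coprimes hRP h h'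
  have b1 : d ∣ P * Q → d ∣ R * P → d ∣ P := fun h h' => by
    have := Nat.dvd_gcd h (mul_comm R P ▸ h')
    rwa [Nat.gcd_mul_left, hQR.gcd_eq_one, mul_one] at this
  have b2 : d ∣ P * Q → d ∣ Q * R → d ∣ Q := fun h h' => by
    have := Nat.dvd_gcd (mul_comm P Q ▸ h) h'
    rwa [Nat.gcd_mul_left, hRP.symm.gcd_eq_one, mul_one] at this
  have b3 : d ∣ Q * R → d ∣ R * P → d ∣ R := fun h h' => by
    have := Nat.dvd_gcd (mul_comm Q R ▸ h) h'
    rwa [Nat.gcd_mul_left, hPQ.symm.gcd_eq_one, mul_one] at this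
  have c1 : d ∣ P * Q → d ∣ P * Q * R := fun h => h.mul_right _
  have c2 : d ∣ Q * R → d ∣ P * Q * R := fun h => by rw [mul_assoc]; exact h.mul_left _
  have c3 : d ∣ R * P → d ∣ P * Q * R := fun h => by
    have e : P * Q * R = R * P * Q := by ring
    rw [e]; exact h.mul_right _
  split_ifs <;> omega

theorem inclusionExclusionPoly_mul_den {P Q R : ℕ} (hP : 0 < P) (hQ : 0 < Q) (hR : 0 < R)
    (hPQ : P.Coprime Q) (hQR : Q.Coprime R) (hRP : R.Coprime P) :
    inclusionExclusionPoly P Q R * ternaryDen P Q R = ternaryNum P Q R := by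
  have hm := ternaryDen_monic hP hQ hR
  have h := modByMonic_add_div (ternaryNum P Q R) (ternaryDen P Q R)
  rw [(modByMonic_eq_zero_iff_dvd hm).2
    (ternaryDen_dvd_ternaryNum hP hQ hR hPQ hQR hRP), zero_add, mul_comm] at h
  exact h

/-! Every residue modulo `P * Q` is `R * (x * P + y * Q)` with unique `x < Q`, `y < P`. For `k < P *
Q * R` in that class, the coefficient of `repSeries` at `k` is `1` or `0` according as `R * (x * P +
y * Q) ≤ k` or not. Multiplying by `1 - X ^ R`, `1 - X ^ Q` and `1 + ... + X ^ (P - 1)` turns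
suitable coefficients of the polynomial into differences of two counts of lattice points
(`coeff_inclusionExclusionPoly`).

If the inverse of `R` modulo `P * Q` is `±v * P + Q`, raising `k` by `1` moves `(x, y)` by `(±v,
1)`, and subtracting `Q` from `k` adds `D ≡ -Q` to `y` modulo `P`. When `v * P` lies between `Q / 4`
and `3 * Q / 4`, a suitable threshold leaves `N` points in one count and none in the other, which
gives the coefficients `N` and `-N`.

Such `P`, `Q`, `R` are found among the powers of `p`, `q`, `r` as solutions of congruences
(`exists_exponents`): `P = T ^ 2`, `Q ≡ 1 - T` and `R ≡ 1 + T` modulo `P`, and `R ≡ (±v * P)⁻¹`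
modulo `Q`. They are solvable because the powers of an integer fill a `p`-adic neighbourhood of `1`
that is independent of the modulus (`exists_large_pow_modEq`). -/

/-! ### Coefficients as differences of lattice point counts -/

/-- The geometric series `1 / (1 - X ^ d)`. -/
noncomputable def geomSeries (d : ℕ) : PowerSeries ℤ :=
  PowerSeries.mk fun n => if d ∣ n then 1 else 0

theorem geomSeries_mul_one_sub {d : ℕ} (hd : 0 < d) :
    geomSeries d * (1 - PowerSeries.X ^ d) = 1 := by
  ext n
  rw [mul_sub, mul_one, map_sub, PowerSeries.coeff_mul_X_pow', PowerSeries.coeff_one]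
  simp only [geomSeries, PowerSeries.coeff_mk]
  rcases Nat.eq_zero_or_pos n with rfl | hn
  · simp [hd.ne']
  · by_cases h : d ≤ n
    · have : d ∣ n - d ↔ d ∣ n := (Nat.dvd_sub_iff_left h dvd_rfl)
      simp [h, this, hn.ne']
    · have : ¬ d ∣ n := fun h' => h (Nat.le_of_dvd hn h')
      simp [h, this, hn.ne']

/-- The generating function of the number of ways to write `k = αQR + βRP + γPQ`. -/
noncomputable def repSeries (P Q R : ℕ) : PowerSeries ℤ :=
  geomSeries (P * Q) * geomSeries (Q * R) * geomSeries (R * P)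

/-- Reduction modulo `P` determines `α` and reduction modulo `Q` determines `β`; the bound on `k`
forces `α < P` and `β < Q`, so the congruences are equalities. -/
theorem eq_of_rep {P Q R : ℕ} (hPQ : P.Coprime Q) (hQR : Q.Coprime R) (hRP : R.Coprime P)
    {k x y α β γ : ℕ} (hk : k < P * Q * R) (hx : x < Q) (hy : y < P)
    (h : k ≡ R * (x * P + y * Q) [MOD P * Q]) (hrep : P * Q * γ + Q * R * α + R * P * β = k) :
    α = y ∧ β = x := by
  have hα : α < P := by
    by_contra! hc
    have : Q * R * P ≤ Q * R * α := Nat.mul_le_mul_left _ hc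
    have e : Q * R * P = P * Q * R := by ring
    omega
  have hβ : β < Q := by
    by_contra! hc
    have : R * P * Q ≤ R * P * β := Nat.mul_le_mul_left _ hc
    have e : R * P * Q = P * Q * R := by ring
    omega
  have hP : Q * R * α ≡ Q * R * y [MOD P] := by
    have h1 := h.of_mul_right Q
    rw [← hrep] at h1
    have e1 : P * Q * γ + Q * R * α + R * P * β = Q * R * α + P * (Q * γ + R * β) := by ring
    have e2 : R * (x * P + y * Q) = Q * R * y + P * (R * x) := by ring
    rw [e1, e2] at h1
    simpa [Nat.ModEq] using h1
  have hQ : R * P * β ≡ R * P * x [MOD Q] := by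
    have h1 := h.of_mul_left P
    rw [← hrep] at h1
    have e1 : P * Q * γ + Q * R * α + R * P * β = R * P * β + Q * (P * γ + R * α) := by ring
    have e2 : R * (x * P + y * Q) = R * P * x + Q * (R * y) := by ring
    rw [e1, e2] at h1
    simpa [Nat.ModEq] using h1
  exact ⟨(Nat.ModEq.cancel_left_of_coprime (hPQ.mul_right hRP.symm) hP).eq_of_lt_of_lt hα hy,
    (Nat.ModEq.cancel_left_of_coprime (hQR.mul_right hPQ.symm) hQ).eq_of_lt_of_lt hβ hx⟩

theorem coeff_repSeries {P Q R : ℕ} (hPQ : P.Coprime Q) (hQR : Q.Coprime R) (hRP : R.Coprime P)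
    {k x y : ℕ} (hk : k < P * Q * R) (hx : x < Q) (hy : y < P)
    (h : k ≡ R * (x * P + y * Q) [MOD P * Q]) :
    PowerSeries.coeff k (repSeries P Q R) = if R * (x * P + y * Q) ≤ k then 1 else 0 := by
  have key : ∀ i j i1 i2 : ℕ, i + j = k → i1 + i2 = i → P * Q ∣ i1 → Q * R ∣ i2 → R * P ∣ j →
      i2 = Q * R * y ∧ j = R * P * x := by
    rintro i j i1 i2 h1 h2 ⟨γ, rfl⟩ ⟨α, rfl⟩ ⟨β, rfl⟩
    obtain ⟨rfl, rfl⟩ := eq_of_rep hPQ hQR hRP hk hx hy h (by rw [h2, h1])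
    exact ⟨rfl, rfl⟩
  simp only [repSeries, PowerSeries.coeff_mul, geomSeries, PowerSeries.coeff_mk]
  split_ifs with hle
  · have e : R * (x * P + y * Q) = R * P * x + Q * R * y := by ring
    rw [Finset.sum_eq_single (k - R * P * x, R * P * x),
      Finset.sum_eq_single (k - R * P * x - Q * R * y, Q * R * y)]
    · have h3 : P * Q ∣ k - R * P * x - Q * R * y := by
        rw [Nat.sub_sub, ← e]
        exact (Nat.modEq_iff_dvd' hle).1 h.symm
      simp [h3]
    · rintro ⟨i1, i2⟩ hi hne
      rw [Finset.HasAntidiagonal.mem_antidiagonal] at hi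
      simp only at hi hne ⊢
      by_contra hc
      simp only [mul_ite, mul_one, mul_zero, ite_eq_right_iff, not_forall] at hc
      obtain ⟨c1, c2, -⟩ := hc
      have := (key _ (R * P * x) i1 i2 (by omega) hi c2 c1 (dvd_mul_right _ _)).1
      exact hne (by rw [Prod.mk.injEq]; omega)
    · intro hc
      rw [Finset.HasAntidiagonal.mem_antidiagonal] at hc
      simp only at hc
      omega
    · rintro ⟨i, j⟩ hi hne
      rw [Finset.HasAntidiagonal.mem_antidiagonal] at hi
      simp only at hi hne ⊢
      by_cases hj : R * P ∣ j
      · rw [if_pos hj, mul_one]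
        refine Finset.sum_eq_zero ?_
        rintro ⟨i1, i2⟩ hi'
        rw [Finset.HasAntidiagonal.mem_antidiagonal] at hi'
        simp only at hi' ⊢
        by_contra hc
        simp only [mul_ite, mul_one, mul_zero, ite_eq_right_iff, not_forall] at hc
        obtain ⟨c1, c2, -⟩ := hc
        have := (key i j i1 i2 hi hi' c2 c1 hj).2
        exact hne (by rw [Prod.mk.injEq]; omega)
      · rw [if_neg hj, mul_zero]
    · intro hc
      rw [Finset.HasAntidiagonal.mem_antidiagonal] at hc
      simp only at hc
      omega
  · refine Finset.sum_eq_zero ?_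
    rintro ⟨i, j⟩ hi
    rw [Finset.HasAntidiagonal.mem_antidiagonal] at hi
    simp only at hi ⊢
    by_cases hj : R * P ∣ j
    · rw [if_pos hj, mul_one]
      refine Finset.sum_eq_zero ?_
      rintro ⟨i1, i2⟩ hi'
      rw [Finset.HasAntidiagonal.mem_antidiagonal] at hi'
      simp only at hi' ⊢
      by_contra hc
      simp only [mul_ite, mul_one, mul_zero, ite_eq_right_iff, not_forall] at hc
      obtain ⟨c1, c2, -⟩ := hc
      obtain ⟨h1, h2⟩ := key i j i1 i2 hi hi' c2 c1 hj
      apply hle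
      have e : R * (x * P + y * Q) = R * P * x + Q * R * y := by ring
      omega
    · rw [if_neg hj, mul_zero]

theorem inclusionExclusionPoly_eq_repSeries {P Q R : ℕ} (hP : 0 < P) (hQ : 0 < Q) (hR : 0 < R)
    (hPQ : P.Coprime Q) (hQR : Q.Coprime R) (hRP : R.Coprime P) :
    (inclusionExclusionPoly P Q R : PowerSeries ℤ) =
      (∑ i ∈ Finset.range P, PowerSeries.X ^ i) *
        ((1 - PowerSeries.X ^ Q) * ((1 - PowerSeries.X ^ R) * repSeries P Q R)) *
        (1 - PowerSeries.X ^ (P * Q * R)) := by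
  have h := congrArg (fun f : ℤ[X] => (f : PowerSeries ℤ))
    (inclusionExclusionPoly_mul_den hP hQ hR hPQ hQR hRP)
  simp only [ternaryNum, ternaryDen, Polynomial.coe_mul, Polynomial.coe_sub, Polynomial.coe_pow,
    Polynomial.coe_X, Polynomial.coe_one] at h
  have g1 := geomSeries_mul_one_sub (Nat.mul_pos hP hQ)
  have g2 := geomSeries_mul_one_sub (Nat.mul_pos hQ hR)
  have g3 := geomSeries_mul_one_sub (Nat.mul_pos hR hP)
  have gs : (∑ i ∈ Finset.range P, (PowerSeries.X : PowerSeries ℤ) ^ i) * (PowerSeries.X - 1) =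
      PowerSeries.X ^ P - 1 := geom_sum_mul _ _
  have hne : (PowerSeries.X - 1 : PowerSeries ℤ) ≠ 0 := by
    intro h0
    have := congrArg (PowerSeries.coeff 0) h0
    simp at this
  apply mul_right_cancel₀ hne
  unfold repSeries
  generalize (inclusionExclusionPoly P Q R : PowerSeries ℤ) = F at *
  generalize geomSeries (P * Q) = a at *
  generalize geomSeries (Q * R) = b at *
  generalize geomSeries (R * P) = c at *
  generalize (PowerSeries.X : PowerSeries ℤ) ^ (P * Q) = xa at *
  generalize (PowerSeries.X : PowerSeries ℤ) ^ (Q * R) = xb at *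
  generalize (PowerSeries.X : PowerSeries ℤ) ^ (R * P) = xc at *
  generalize (PowerSeries.X : PowerSeries ℤ) ^ (P * Q * R) = xd at *
  generalize (∑ i ∈ Finset.range P, (PowerSeries.X : PowerSeries ℤ) ^ i) = S at *
  generalize (PowerSeries.X : PowerSeries ℤ) ^ P = xP at *
  generalize (PowerSeries.X : PowerSeries ℤ) ^ Q = xQ at *
  generalize (PowerSeries.X : PowerSeries ℤ) ^ R = xR at *
  generalize (PowerSeries.X : PowerSeries ℤ) = x at *
  calc F * (x - 1) = F * (x - 1) * (a * (1 - xa)) * (b * (1 - xb)) * (c * (1 - xc)) := by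
        rw [g1, g2, g3]; ring
    _ = -(F * ((xa - 1) * (xb - 1) * (xc - 1) * (x - 1))) * (a * b * c) := by ring
    _ = -((xd - 1) * (S * (x - 1)) * (xQ - 1) * (xR - 1)) * (a * b * c) := by rw [h, gs]
    _ = _ := by ring

theorem coeff_one_sub_X_pow_mul (d k : ℕ) (f : PowerSeries ℤ) :
    PowerSeries.coeff k ((1 - PowerSeries.X ^ d) * f) =
      PowerSeries.coeff k f - if d ≤ k then PowerSeries.coeff (k - d) f else 0 := by
  rw [sub_mul, one_mul, map_sub, PowerSeries.coeff_X_pow_mul']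

/-- Since `μ * P + l * Q ≡ 1`, passing from `k` to `k - R` moves `(x, y)` to `(x - μ, y - l)`. As `x
< μ`, the first coordinate wraps around. If `y ≥ l` only that one wraps, both thresholds agree and
the two terms cancel. If `y < l` both wrap, the new threshold exceeds `k - R`, and only the first
term survives. -/
theorem coeff_one_sub_mul_repSeries {P Q R : ℕ}
    (hPQ : P.Coprime Q) (hQR : Q.Coprime R) (hRP : R.Coprime P)
    {l μ : ℕ} (hl : l < P) (hμQ : μ ≤ Q) (hlμ : μ * P + l * Q = P * Q + 1)
    {k x y : ℕ} (hRk : R ≤ k) (hk : k < P * Q * R) (hx : x < μ) (hy : y < P)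
    (h : k ≡ R * (x * P + y * Q) [MOD P * Q]) :
    PowerSeries.coeff k ((1 - PowerSeries.X ^ R) * repSeries P Q R) =
      if y < l ∧ R * (x * P + y * Q) ≤ k then 1 else 0 := by
  have hR : 0 < R := Nat.pos_of_ne_zero (by rintro rfl; simp at hk)
  have hμ : 0 < μ := by omega
  rw [coeff_one_sub_X_pow_mul, if_pos hRk, coeff_repSeries hPQ hQR hRP hk (by omega) hy h]
  obtain ⟨x', hx'⟩ : ∃ x', x' + μ = x + Q := ⟨x + Q - μ, by omega⟩
  by_cases hyl : y < l
  · obtain ⟨y', hy'⟩ : ∃ y', y' + l = y + P := ⟨y + P - l, by omega⟩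
    have e : x' * P + y' * Q + 1 = x * P + y * Q + P * Q := by
      zify at hx' hy' hlμ ⊢
      linear_combination P * hx' + Q * hy' - hlμ
    have h' : k - R ≡ R * (x' * P + y' * Q) [MOD P * Q] := by
      apply Nat.ModEq.add_right_cancel' R
      rw [Nat.sub_add_cancel hRk]
      have e2 : R * (x' * P + y' * Q) + R = R * (x * P + y * Q) + P * Q * R := by
        calc _ = R * (x' * P + y' * Q + 1) := by ring
          _ = _ := by rw [e]; ring
      rw [e2]
      refine h.trans ?_
      simp [Nat.ModEq]
    rw [coeff_repSeries hPQ hQR hRP (by omega) (by omega) (by omega) h']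
    have hn : ¬ R * (x' * P + y' * Q) ≤ k - R := by
      intro hc
      have : R * (x' * P + y' * Q) + R = R * (x * P + y * Q) + P * Q * R := by
        calc _ = R * (x' * P + y' * Q + 1) := by ring
          _ = _ := by rw [e]; ring
      omega
    simp [hn, hyl]
  · obtain ⟨y', rfl⟩ : ∃ y', y = y' + l := ⟨y - l, by omega⟩
    have e : x' * P + y' * Q + 1 = x * P + (y' + l) * Q := by
      zify at hx' hlμ ⊢
      linear_combination P * hx' - hlμ
    have e2 : R * (x * P + (y' + l) * Q) = R * (x' * P + y' * Q) + R := by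
      rw [← e]; ring
    have h' : k - R ≡ R * (x' * P + y' * Q) [MOD P * Q] := by
      apply Nat.ModEq.add_right_cancel' R
      rw [Nat.sub_add_cancel hRk, ← e2]
      exact h
    rw [coeff_repSeries hPQ hQR hRP (by omega) (by omega) (by omega) h', e2]
    have : R * (x' * P + y' * Q) + R ≤ k ↔ R * (x' * P + y' * Q) ≤ k - R := by omega
    simp [this]

/-- All indices `K + y` and `K + y - Q` lie in the window from `R * M` to `R * (M + 1)`, where `R *
m ≤ k` means `m ≤ M`. The window ends by `P * Q * R`, so the factor `1 - X ^ (P * Q * R)` has no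
effect. -/
theorem coeff_inclusionExclusionPoly {P Q R : ℕ} (hP : 0 < P) (hQ : 0 < Q)
    (hPQ : P.Coprime Q) (hQR : Q.Coprime R) (hRP : R.Coprime P)
    {l μ : ℕ} (hl : l < P) (hμQ : μ ≤ Q) (hlμ : μ * P + l * Q = P * Q + 1)
    {K M : ℕ} (hM : 0 < M) (hMPQ : M < P * Q) (hK : R * M + Q ≤ K) (hK' : K + P ≤ R * (M + 1))
    (x z : ℕ → ℕ) (hx : ∀ y < P, x y < μ) (hz : ∀ y < P, z y < P)
    (h1 : ∀ y < P, K + y ≡ R * (x y * P + y * Q) [MOD P * Q])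
    (h2 : ∀ y < P, K + y ≡ Q + R * (x y * P + z y * Q) [MOD P * Q]) :
    (inclusionExclusionPoly P Q R).coeff (K + P - 1) =
      ∑ y ∈ Finset.range P, ((if y < l ∧ x y * P + y * Q ≤ M then 1 else 0) -
        (if z y < l ∧ x y * P + z y * Q ≤ M then 1 else 0)) := by
  have hR : 0 < R := Nat.pos_of_ne_zero (by rintro rfl; omega)
  have hRM : R ≤ R * M := Nat.le_mul_of_pos_right _ hM
  have hb : R * (M + 1) ≤ P * Q * R := by
    rw [mul_comm (P * Q)]; exact Nat.mul_le_mul_left _ hMPQ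
  have hcut : ∀ k m : ℕ, R * M ≤ k → k < R * (M + 1) → (R * m ≤ k ↔ m ≤ M) := by
    intro k m hk hk'
    constructor
    · intro hm
      exact Nat.lt_succ_iff.1 (Nat.lt_of_mul_lt_mul_left (hm.trans_lt hk'))
    · intro hm
      exact (Nat.mul_le_mul_left _ hm).trans hk
  rw [← Polynomial.coeff_coe, inclusionExclusionPoly_eq_repSeries hP hQ hR hPQ hQR hRP,
    mul_comm _ (1 - _), coeff_one_sub_X_pow_mul, if_neg (by omega), sub_zero, Finset.sum_mul,
    map_sum, ← Finset.sum_range_reflect]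
  refine Finset.sum_congr rfl fun y hy => ?_
  rw [Finset.mem_range] at hy
  rw [PowerSeries.coeff_X_pow_mul', if_pos (by omega),
    show K + P - 1 - (P - 1 - y) = K + y by omega, coeff_one_sub_X_pow_mul, if_pos (by omega),
    coeff_one_sub_mul_repSeries hPQ hQR hRP hl hμQ hlμ (by omega) (by omega) (hx y hy) hy
      (h1 y hy),
    coeff_one_sub_mul_repSeries (k := K + y - Q) hPQ hQR hRP hl hμQ hlμ (by omega) (by omega)
      (hx y hy) (hz y hy) ?_]
  · simp only [hcut (K + y) _ (by omega) (by omega), hcut (K + y - Q) _ (by omega) (by omega)]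
  · apply Nat.ModEq.add_left_cancel' Q
    rw [show Q + (K + y - Q) = K + y by omega]
    exact h2 y hy

/-! ### Powers of an integer modulo prime powers -/

theorem exists_modEq_mem_Ico {m : ℕ} (hm : 0 < m) (a : ℤ) (L : ℕ) :
    ∃ K : ℕ, (K : ℤ) ≡ a [ZMOD m] ∧ L ≤ K ∧ K < L + m := by
  have hm' : (0 : ℤ) < m := by exact_mod_cast hm
  have h0 := Int.emod_nonneg (a - L) hm'.ne'
  have h1 := Int.emod_lt_of_pos (a - L) hm'
  obtain ⟨t, ht⟩ := Int.eq_ofNat_of_zero_le h0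
  refine ⟨L + t, ?_, by omega, by omega⟩
  push_cast
  rw [← ht]
  have := (Int.mod_modEq (a - L) m).add_left (L : ℤ)
  simpa using this

/-- Raising to the `p`-th power lifts the exact order of congruence to `1` by one. -/
theorem exists_pow_prime_eq_one_add {p : ℕ} (hp : p.Prime) {k : ℕ} (hk : k + 2 ≤ p * k)
    {u : ℤ} (hu : ¬ (p : ℤ) ∣ u) (n : ℕ) :
    ∃ w : ℤ, (1 + (p : ℤ) ^ k * u) ^ p ^ n = 1 + (p : ℤ) ^ (k + n) * w ∧ ¬ (p : ℤ) ∣ w := by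
  have hk0 : k ≠ 0 := by rintro rfl; simp at hk
  obtain ⟨y, hy⟩ := ZMod.exists_one_add_mul_pow_prime_pow_eq (R := ℤ) (u := (p : ℤ) ^ k)
    (v := p) hp (dvd_pow_self _ hk0)
    (by rw [← pow_succ', ← pow_succ, ← pow_mul, mul_comm k p]; exact pow_dvd_pow _ hk) u n
  refine ⟨u + p * y, by rw [hy]; ring, fun h => hu ?_⟩
  exact (dvd_add_left (dvd_mul_right _ _)).1 h

/-- The exponent is built one `p`-adic digit at a time: the `p ^ a`-th power of the base is `1 + p ^
(k + a) * w` with `p ∤ w`, so a power of it corrects the next digit. -/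
theorem exists_pow_modEq_prime_pow {p : ℕ} (hp : p.Prime) {k : ℕ} (hk : k + 2 ≤ p * k)
    {u : ℤ} (hu : ¬ (p : ℤ) ∣ u) {y : ℤ} (hy : y ≡ 1 [ZMOD (p : ℤ) ^ k]) (a : ℕ) :
    ∃ m : ℕ, (1 + (p : ℤ) ^ k * u) ^ m ≡ y [ZMOD (p : ℤ) ^ (k + a)] := by
  have hk0 : k ≠ 0 := by rintro rfl; simp at hk
  have hp' : Prime (p : ℤ) := Nat.prime_iff_prime_int.1 hp
  induction a with
  | zero => exact ⟨0, by simpa using hy.symm⟩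
  | succ a ih =>
    obtain ⟨m, hm⟩ := ih
    obtain ⟨t, ht⟩ := hm.dvd
    obtain ⟨w, hw, hpw⟩ := exists_pow_prime_eq_one_add hp hk hu a
    have hcop : IsCoprime w (p : ℤ) := ((Prime.coprime_iff_not_dvd hp').2 hpw).symm
    obtain ⟨s, s', hs⟩ := hcop
    -- `s` inverts `w` modulo `p` and `t` is the digit still missing, so `w * j ≡ t`.
    obtain ⟨j, hj, -, -⟩ := exists_modEq_mem_Ico hp.pos (s * t) 0
    refine ⟨m + p ^ a * j, ?_⟩
    have h1 : (1 + (p : ℤ) ^ k * u) ^ m ≡ 1 [ZMOD p] := by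
      have : 1 + (p : ℤ) ^ k * u ≡ 1 [ZMOD p] := by
        rw [Int.modEq_comm, Int.modEq_iff_dvd, add_sub_cancel_left]
        exact (dvd_pow_self _ hk0).mul_right _
      simpa using this.pow m
    have h2 : (1 + (p : ℤ) ^ (k + a) * w) ^ j ≡ 1 + (p : ℤ) ^ (k + a) * (w * j)
        [ZMOD (p : ℤ) ^ (k + (a + 1))] := by
      obtain ⟨c, hc⟩ := Polynomial.powAddExpansion 1 ((p : ℤ) ^ (k + a) * w) j
      rw [hc, Int.modEq_comm, Int.modEq_iff_dvd]
      have : (p : ℤ) ^ (k + (a + 1)) ∣ ((p : ℤ) ^ (k + a)) ^ 2 := by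
        rw [← pow_mul]; exact pow_dvd_pow _ (by omega)
      obtain ⟨d, hd⟩ := this
      exact ⟨d * w ^ 2 * c, by simp only [one_pow]; linear_combination (w ^ 2 * c) * hd⟩
    rw [pow_add _ m, pow_mul, hw]
    refine (h2.mul_left _).trans ?_
    obtain ⟨b, hb⟩ := h1.dvd
    obtain ⟨d, hd⟩ := hj.dvd
    rw [Int.modEq_iff_dvd]
    have e : y = (1 + (p : ℤ) ^ k * u) ^ m + (p : ℤ) ^ (k + a) * t := by linear_combination ht
    generalize (1 + (p : ℤ) ^ k * u) ^ m = z at *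
    refine ⟨t * s' + w * d + w * j * b, ?_⟩
    rw [e, ← add_assoc k a 1, pow_succ]
    linear_combination (p : ℤ) ^ (k + a) * (-t * hs + w * hd + w * j * hb)

/-- The powers of an integer congruent to `1` exhaust, modulo every power of `p`, a whole
neighbourhood of `1`, and this neighbourhood does not depend on the modulus. -/
theorem exists_forall_pow_modEq {p : ℕ} (hp : p.Prime) {x : ℤ} (hx1 : x ≠ 1)
    (hpx : (p : ℤ) ∣ x - 1) (h4 : p = 2 → (4 : ℤ) ∣ x - 1) :
    ∃ k : ℕ, 0 < k ∧ ∀ (a : ℕ) (y : ℤ), y ≡ 1 [ZMOD (p : ℤ) ^ k] →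
      ∃ m₀ : ℕ, ∀ m : ℕ, m ≡ m₀ [MOD p ^ a] → x ^ m ≡ y [ZMOD (p : ℤ) ^ a] := by
  have hfin : FiniteMultiplicity (p : ℤ) (x - 1) := by
    rw [Int.finiteMultiplicity_iff]
    exact ⟨by simpa using hp.ne_one, sub_ne_zero.2 hx1⟩
  obtain ⟨u, hu, hpu⟩ := hfin.exists_eq_pow_mul_and_not_dvd
  have hx : x = 1 + (p : ℤ) ^ multiplicity (p : ℤ) (x - 1) * u := by linear_combination hu
  have hk1 : 1 ≤ multiplicity (p : ℤ) (x - 1) :=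
    hfin.le_multiplicity_of_pow_dvd (by simpa using hpx)
  have hk2 : p = 2 → 2 ≤ multiplicity (p : ℤ) (x - 1) := fun h =>
    hfin.le_multiplicity_of_pow_dvd (by subst h; simpa using h4 rfl)
  generalize multiplicity (p : ℤ) (x - 1) = k at *
  -- This fails for `p = 2`, `k = 1`, which is why divisibility by `4` is assumed there.
  have hk : k + 2 ≤ p * k := by
    rcases hp.two_le.eq_or_lt with h | h
    · have := hk2 h.symm
      rw [← h]; omega
    · nlinarith
  refine ⟨k, hk1, fun a y hy => ?_⟩
  obtain ⟨m₀, hm₀⟩ := exists_pow_modEq_prime_pow hp hk hpu hy a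
  rw [← hx] at hm₀
  have hm₀ := hm₀.of_dvd (pow_dvd_pow _ (Nat.le_add_left a k))
  obtain ⟨w, hw, -⟩ := exists_pow_prime_eq_one_add hp hk hpu a
  rw [← hx] at hw
  have h1 : x ^ p ^ a ≡ 1 [ZMOD (p : ℤ) ^ a] := by
    rw [hw, Int.modEq_comm, Int.modEq_iff_dvd, add_sub_cancel_left]
    exact (pow_dvd_pow _ (Nat.le_add_left a k)).mul_right _
  have hred : ∀ m : ℕ, x ^ m ≡ x ^ (m % p ^ a) [ZMOD (p : ℤ) ^ a] := by
    intro m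
    conv_lhs => rw [← Nat.div_add_mod m (p ^ a), pow_add, pow_mul]
    simpa using (h1.pow (m / p ^ a)).mul_right (x ^ (m % p ^ a))
  refine ⟨m₀, fun m hm => ((hred m).trans ?_).trans hm₀⟩
  rw [show m % p ^ a = m₀ % p ^ a from hm]
  exact (hred m₀).symm

theorem prime_dvd_pow_sub_one {p x e : ℕ} (hp : p.Prime) (hx : p.Coprime x) (he : p - 1 ∣ e) :
    (p : ℤ) ∣ (x : ℤ) ^ (2 * e) - 1 ∧ (p = 2 → (4 : ℤ) ∣ (x : ℤ) ^ (2 * e) - 1) := by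
  obtain ⟨f, rfl⟩ := he
  constructor
  · have h := Int.ModEq.pow_card_sub_one_eq_one hp (n := (x : ℤ))
      (Nat.isCoprime_iff_coprime.2 hx.symm)
    have h2 := (h.pow (f * 2)).symm.dvd
    rw [one_pow, ← pow_mul] at h2
    rwa [show 2 * ((p - 1) * f) = (p - 1) * (f * 2) by ring]
  · rintro rfl
    have hodd : Odd x := Nat.coprime_two_left.1 hx
    have h := (Int.sq_mod_four_eq_one_of_odd (x := (x : ℤ)) (by exact_mod_cast hodd))
    have h2 : (x : ℤ) ^ 2 ≡ 1 [ZMOD 4] := h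
    have h3 := (h2.pow ((2 - 1) * f)).symm.dvd
    rwa [one_pow, ← pow_mul] at h3

/-- Powers of `x` with large exponents, simultaneously modulo powers of two primes. -/
theorem exists_large_pow_modEq {p q x : ℕ} (hp : p.Prime) (hq : q.Prime) (hpq : p ≠ q)
    (hx : 1 < x) (hpx : p.Coprime x) (hqx : q.Coprime x) :
    ∃ k l : ℕ, 0 < k ∧ 0 < l ∧ ∀ (a b B : ℕ) (y z : ℤ), y ≡ 1 [ZMOD (p : ℤ) ^ k] →
      z ≡ 1 [ZMOD (q : ℤ) ^ l] → ∃ m : ℕ, B ≤ m ∧ (x : ℤ) ^ m ≡ y [ZMOD (p : ℤ) ^ a] ∧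
        (x : ℤ) ^ m ≡ z [ZMOD (q : ℤ) ^ b] := by
  -- By Fermat `x ^ (2 * e)` is `1` modulo both primes; the factor `2` makes it `1` modulo `4` if
  -- one of them is `2`.
  set e := (p - 1) * (q - 1) with he
  have he0 : e ≠ 0 := by
    have := hp.two_le
    have := hq.two_le
    exact mul_ne_zero (by omega) (by omega)
  obtain ⟨hp1, hp4⟩ := prime_dvd_pow_sub_one (e := e) hp hpx (dvd_mul_right _ _)
  obtain ⟨hq1, hq4⟩ := prime_dvd_pow_sub_one (e := e) hq hqx (dvd_mul_left _ _)
  have hx1 : (x : ℤ) ^ (2 * e) ≠ 1 := by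
    have : 1 < x ^ (2 * e) := Nat.one_lt_pow (by omega) hx
    exact_mod_cast this.ne'
  obtain ⟨k, hk, Hk⟩ := exists_forall_pow_modEq hp hx1 hp1 hp4
  obtain ⟨l, hl, Hl⟩ := exists_forall_pow_modEq hq hx1 hq1 hq4
  refine ⟨k, l, hk, hl, fun a b B y z hy hz => ?_⟩
  obtain ⟨m₁, h₁⟩ := Hk a y hy
  obtain ⟨m₂, h₂⟩ := Hl b z hz
  have hcop : (p ^ a).Coprime (q ^ b) := Nat.Coprime.pow _ _ ((Nat.coprime_primes hp hq).2 hpq)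
  -- The admissible exponents form classes modulo the coprime numbers `p ^ a` and `q ^ b`, so both
  -- conditions can be met at once.
  obtain ⟨m, hm₁, hm₂⟩ := Nat.chineseRemainder hcop m₁ m₂
  have hpos : 0 < p ^ a * q ^ b := Nat.mul_pos (pow_pos hp.pos _) (pow_pos hq.pos _)
  refine ⟨2 * e * (m + p ^ a * q ^ b * B), ?_, ?_, ?_⟩
  · calc B ≤ p ^ a * q ^ b * B := Nat.le_mul_of_pos_left _ hpos
      _ ≤ m + p ^ a * q ^ b * B := Nat.le_add_left _ _
      _ ≤ _ := Nat.le_mul_of_pos_left _ (by omega)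
  · rw [pow_mul]
    refine h₁ _ (Nat.ModEq.trans ?_ hm₁)
    rw [mul_assoc]
    simp [Nat.ModEq]
  · rw [pow_mul]
    refine h₂ _ (Nat.ModEq.trans ?_ hm₂)
    rw [mul_comm (p ^ a), mul_assoc]
    simp [Nat.ModEq]

/-! ### Triples with a prescribed coefficient -/

theorem natCast_modEq_of_dvd_sub {m a b : ℕ} (h : (m : ℤ) ∣ (a : ℤ) - b) : a ≡ b [MOD m] :=
  (Nat.modEq_iff_dvd.2 h).symm

/-- Subtraction of `Q` modulo `P`, where `Q + D` is divisible by `P`. -/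
theorem shift_dvd {P Q R D w y z : ℤ} (hD : P ∣ Q + D) (hw : P ∣ w - Q) (hwR : P ∣ w * R - 1)
    (hz : P ∣ y + D - z) : P * Q ∣ R * (y * Q) - (Q + R * (z * Q)) := by
  obtain ⟨a, ha⟩ := hD
  obtain ⟨b, hb⟩ := hw
  obtain ⟨c, hc⟩ := hwR
  obtain ⟨d, hd⟩ := hz
  exact ⟨-R * a + R * d + c - R * b,
    by linear_combination Q * (-R * ha + R * hd + hc - R * hb)⟩

/-- The index `K + y` has coordinates `(1 + v * y, y)`, with value `P + y * (v * P + Q)`; the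
threshold `M` admits exactly `y < N`. The bounds on the index serve to compare the positions of the
coefficients for different `N`. -/
theorem exists_coeff_eq_natCast {P Q R : ℕ}
    (hPQ : P.Coprime Q) (hQR : Q.Coprime R) (hRP : R.Coprime P)
    {l μ D v N : ℕ} (hl : 8 * l ≤ P) (hlμ : μ * P + l * Q = P * Q + 1)
    (hv : (P * Q : ℤ) ∣ (v * P + Q) * R - 1) (hD : P ∣ Q + D) (hD0 : 0 < D) (hND : 2 * N ≤ D)
    (hDP : D + 8 * N ≤ P) (hNl : N ≤ l) (hvQ : Q ≤ 4 * (v * P)) (hvQ' : 4 * (v * P) ≤ 3 * Q)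
    (hPQ8 : 8 * P ≤ Q) (hP2 : 2 ≤ P) (hR : P * Q + P + Q ≤ R) :
    ∃ n, R * (P + N * (v * P + Q) - 1) ≤ n ∧ n < R * (P + N * (v * P + Q)) ∧
      (inclusionExclusionPoly P Q R).coeff n = N := by
  have hQ : 0 < Q := by omega
  obtain ⟨M, hM⟩ : ∃ M, M + 1 = P + N * (v * P + Q) := ⟨P + N * (v * P + Q) - 1, by omega⟩
  -- The residue of `K` puts offset `0` at the point `(1, 0)`.
  obtain ⟨K, hK, hK1, hK2⟩ := exists_modEq_mem_Ico (m := P * Q) (Nat.mul_pos (by omega) hQ)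
    (P * R) (R * M + Q)
  have hRM : R * (M + 1) = R * M + R := by ring
  rw [← hM, Nat.add_sub_cancel]
  refine ⟨K + P - 1, by omega, by omega, ?_⟩
  have hμQ : μ ≤ Q := by
    by_contra! hc
    have : (Q + 1) * P ≤ μ * P := Nat.mul_le_mul_right _ hc
    nlinarith
  have hNw : N * (v * P + Q) ≤ N * (2 * Q) := Nat.mul_le_mul_left _ (by omega)
  have hMPQ : M < P * Q := by
    have : (2 * N + 1) * Q ≤ P * Q := Nat.mul_le_mul_right _ (by omega)
    nlinarith
  let z : ℕ → ℕ := fun y => if y + D < P then y + D else y + D - P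
  have hz : ∀ y < P, z y < P := by
    intro y hy
    simp only [z]
    split_ifs <;> omega
  have hzd : ∀ y < P, (P : ℤ) ∣ y + D - z y := by
    intro y hy
    simp only [z]
    split_ifs with h
    · simp
    · rw [Nat.cast_sub (by omega)]; simp
  -- `8 * l ≤ P` gives `μ * P > 7 * P * Q / 8`, while `v * y * P ≤ 3 * P * Q / 4`.
  have hx : ∀ y < P, 1 + v * y < μ := by
    intro y hy
    refine Nat.lt_of_mul_lt_mul_right (a := P) ?_
    have h1 : 4 * (v * P) * y ≤ 3 * Q * P :=
      (Nat.mul_le_mul_right _ hvQ').trans (Nat.mul_le_mul_left _ hy.le)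
    have h2 : 8 * l * Q ≤ P * Q := Nat.mul_le_mul_right _ hl
    have h3 : 8 * P * P ≤ Q * P := Nat.mul_le_mul_right _ hPQ8
    nlinarith
  have h1 : ∀ y < P, ((P * Q : ℕ) : ℤ) ∣
      ((K + y : ℕ) : ℤ) - (R * ((1 + v * y) * P + y * Q) : ℕ) := by
    intro y hy
    push_cast at hK ⊢
    have e : (K : ℤ) + y - R * ((1 + v * y) * P + y * Q) =
      (K - P * R) - y * ((v * P + Q) * R - 1) := by ring
    rw [e]
    exact dvd_sub hK.symm.dvd (hv.mul_left _)
  have hPw : (P : ℤ) ∣ (v * P + Q) * R - 1 := (dvd_mul_right _ _).trans hv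
  rw [coeff_inclusionExclusionPoly (M := M) (l := l) (by omega) hQ hPQ hQR hRP (by omega) hμQ hlμ
    (by omega) hMPQ hK1 (by omega) (fun y => 1 + v * y) z hx hz
    (fun y hy => natCast_modEq_of_dvd_sub (h1 y hy))
    (fun y hy => natCast_modEq_of_dvd_sub ?_)]
  · have : ∀ y ∈ Finset.range P,
        (((if y < l ∧ (1 + v * y) * P + y * Q ≤ M then 1 else 0) -
        (if z y < l ∧ (1 + v * y) * P + z y * Q ≤ M then 1 else 0) : ℤ)) =
          if y < N then 1 else 0 := by
      intro y hy
      rw [Finset.mem_range] at hy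
      have hfirst : (y < l ∧ (1 + v * y) * P + y * Q ≤ M) ↔ y < N := by
        have e : (1 + v * y) * P + y * Q = P + y * (v * P + Q) := by ring
        rw [e]
        constructor
        · rintro ⟨-, h⟩
          exact Nat.lt_of_mul_lt_mul_right (a := v * P + Q) (by omega)
        · intro h
          have : y * (v * P + Q) < N * (v * P + Q) := Nat.mul_lt_mul_of_pos_right h (by omega)
          omega
      -- Here `M < P + 2 * N * Q`. Without wraparound `z y ≥ D ≥ 2 * N`; with it `y ≥ 8 * N`, and
      -- then `v * y * P ≥ 2 * N * Q`.
      have hsecond : ¬ (z y < l ∧ (1 + v * y) * P + z y * Q ≤ M) := by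
        rintro ⟨-, h⟩
        have h3 : 2 * N * Q ≤ v * y * P + z y * Q := by
          by_cases hlt : y + D < P
          · have hz1 : z y = y + D := if_pos hlt
            rw [hz1]
            have : 2 * N * Q ≤ D * Q := Nat.mul_le_mul_right _ hND
            have e : v * y * P + (y + D) * Q = v * y * P + y * Q + D * Q := by ring
            exact e ▸ this.trans (Nat.le_add_left _ _)
          · have hz1 : z y = y + D - P := if_neg hlt
            have h8 : 8 * N ≤ y := by omega
            have : Q * (8 * N) ≤ 4 * (v * P) * y := Nat.mul_le_mul hvQ h8
            have e1 : Q * (8 * N) = 4 * (2 * N * Q) := by ring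
            have e2 : 4 * (v * P) * y = 4 * (v * y * P) := by ring
            omega
        have e1 : (1 + v * y) * P = P + v * y * P := by ring
        have e2 : N * (2 * Q) = 2 * N * Q := by ring
        omega
      simp [hfirst, hsecond]
    rw [Finset.sum_congr rfl this, Finset.sum_boole,
      show (Finset.range P).filter (· < N) = Finset.range N by ext; simp; omega]
    simp
  · have h4 := shift_dvd (Q := (Q : ℤ)) (D := D) (by exact_mod_cast hD) (w := v * P + Q) (by simp) hPw
      (hzd y hy)
    rw [← Nat.cast_mul P Q] at h4
    obtain ⟨e, he⟩ := dvd_add (h1 y hy) h4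
    refine ⟨e, ?_⟩
    push_cast at he ⊢
    linear_combination he

/-- Now `x` decreases along the window, from `u * P`. Every point of the first count has value at
least `u * P * P > M`. In the second count the wrapped points `y = P - D + t` have value `u * P * D
+ t * g` with `g = Q - u * P`, and `M` admits exactly `t < N`. -/
theorem exists_coeff_eq_neg_natCast {P Q R : ℕ}
    (hPQ : P.Coprime Q) (hQR : Q.Coprime R) (hRP : R.Coprime P)
    {l μ D u N : ℕ} (hl : 8 * l ≤ P) (hlμ : μ * P + l * Q = P * Q + 1)
    (hu : (P * Q : ℤ) ∣ (-u * P + Q) * R - 1) (hD : P ∣ Q + D) (hD0 : 0 < D) (hND : 2 * N ≤ D)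
    (hDP : D + 8 * N ≤ P) (hNl : N ≤ l) (huQ : Q ≤ 4 * (u * P)) (huQ' : 4 * (u * P) ≤ 3 * Q)
    (hPQ8 : 8 * P ≤ Q) (hP2 : 2 ≤ P) (hR : P * Q + P + Q ≤ R) :
    ∃ n, (inclusionExclusionPoly P Q R).coeff n = -N := by
  have hQ : 0 < Q := by omega
  obtain ⟨g, hg⟩ : ∃ g, g + u * P = Q := ⟨Q - u * P, by omega⟩
  have huP : 2 ≤ u * P := by omega
  have huPD : u * P ≤ u * P * D := Nat.le_mul_of_pos_right _ hD0
  obtain ⟨M, hM⟩ : ∃ M, M + 1 = u * P * D + N * g := ⟨u * P * D + N * g - 1, by omega⟩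
  obtain ⟨K, hK, hK1, hK2⟩ := exists_modEq_mem_Ico (m := P * Q) (Nat.mul_pos (by omega) hQ)
    (u * P * P * R) (R * M + Q)
  have hRM : R * (M + 1) = R * M + R := by ring
  refine ⟨K + P - 1, ?_⟩
  have hμQ : μ ≤ Q := by
    by_contra! hc
    have : (Q + 1) * P ≤ μ * P := Nat.mul_le_mul_right _ hc
    nlinarith
  have hbig : M + 1 ≤ u * P * P := by
    have h1 : u * P * (D + 8 * N) ≤ u * P * P := Nat.mul_le_mul_left _ hDP
    have h2 : N * g ≤ N * (4 * (u * P)) := Nat.mul_le_mul_left _ (by omega)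
    nlinarith
  have hMPQ : M < P * Q := by
    have : u * P * P ≤ Q * P := Nat.mul_le_mul_right _ (by omega)
    nlinarith
  let z : ℕ → ℕ := fun y => if y + D < P then y + D else y + D - P
  have hz : ∀ y < P, z y < P := by
    intro y hy
    simp only [z]
    split_ifs <;> omega
  have hzd : ∀ y < P, (P : ℤ) ∣ y + D - z y := by
    intro y hy
    simp only [z]
    split_ifs with h
    · simp
    · rw [Nat.cast_sub (by omega)]; simp
  have hx : ∀ y < P, u * (P - y) < μ := by
    intro y hy
    refine Nat.lt_of_mul_lt_mul_right (a := P) ?_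
    have h1 : u * (P - y) * P ≤ u * P * P :=
      Nat.mul_le_mul_right _ (Nat.mul_le_mul_left _ (Nat.sub_le _ _))
    have h2 : 8 * l * Q ≤ P * Q := Nat.mul_le_mul_right _ hl
    have h3 : 4 * (u * P) * P ≤ 3 * Q * P := Nat.mul_le_mul_right _ huQ'
    nlinarith
  have h1 : ∀ y < P, ((P * Q : ℕ) : ℤ) ∣
      ((K + y : ℕ) : ℤ) - (R * (u * (P - y) * P + y * Q) : ℕ) := by
    intro y hy
    push_cast [Nat.cast_sub hy.le] at hK ⊢
    have e : (K : ℤ) + y - R * (u * (P - y) * P + y * Q) =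
      (K - u * P * P * R) - y * ((-u * P + Q) * R - 1) := by ring
    rw [e]
    exact dvd_sub hK.symm.dvd (hu.mul_left _)
  have hPw : (P : ℤ) ∣ (-u * P + Q) * R - 1 := (dvd_mul_right _ _).trans hu
  rw [coeff_inclusionExclusionPoly (M := M) (l := l) (by omega) hQ hPQ hQR hRP (by omega) hμQ hlμ
    (by omega) hMPQ hK1 (by omega) (fun y => u * (P - y)) z hx hz
    (fun y hy => natCast_modEq_of_dvd_sub (h1 y hy))
    (fun y hy => natCast_modEq_of_dvd_sub ?_)]
  · have : ∀ y ∈ Finset.range P,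
        (((if y < l ∧ u * (P - y) * P + y * Q ≤ M then 1 else 0) -
        (if z y < l ∧ u * (P - y) * P + z y * Q ≤ M then 1 else 0) : ℤ)) =
          -if P - D ≤ y ∧ y < P - D + N then 1 else 0 := by
      intro y hy
      rw [Finset.mem_range] at hy
      have hge : ∀ s, y ≤ s → M < u * (P - y) * P + s * Q := by
        intro s hs
        obtain ⟨t, rfl⟩ : ∃ t, P = y + t := ⟨P - y, by omega⟩
        rw [Nat.add_sub_cancel_left]
        have h6 : y * (u * (y + t)) ≤ s * Q := Nat.mul_le_mul hs (by omega)
        have e : u * (y + t) * (y + t) = u * t * (y + t) + y * (u * (y + t)) := by ring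
        omega
      have hfirst : ¬ (y < l ∧ u * (P - y) * P + y * Q ≤ M) := fun h =>
        absurd h.2 (not_le.2 (hge y le_rfl))
      have hsecond : (z y < l ∧ u * (P - y) * P + z y * Q ≤ M) ↔
          (P - D ≤ y ∧ y < P - D + N) := by
        by_cases hlt : y + D < P
        · have hz1 : z y = y + D := if_pos hlt
          rw [hz1]
          have := hge (y + D) (by omega)
          omega
        · have hz1 : z y = y + D - P := if_neg hlt
          obtain ⟨t, ht⟩ : ∃ t, y = P - D + t := ⟨y - (P - D), by omega⟩
          have hzt : z y = t := by omega
          obtain ⟨s, hs⟩ : ∃ s, t + s = D := ⟨P - y, by omega⟩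
          have hPy : P - y = s := by omega
          rw [hzt, hPy]
          have e : u * s * P + t * Q = u * P * D + t * g := by
            rw [← hs, ← hg]; ring
          rw [e]
          constructor
          · rintro ⟨-, h⟩
            have : t < N := Nat.lt_of_mul_lt_mul_right (a := g) (by omega)
            omega
          · rintro ⟨-, h⟩
            have : t * g < N * g := Nat.mul_lt_mul_of_pos_right (by omega) (by omega)
            omega
      simp [hfirst, hsecond]
    rw [Finset.sum_congr rfl this, Finset.sum_neg_distrib, Finset.sum_boole,
      show (Finset.range P).filter (fun y => P - D ≤ y ∧ y < P - D + N) =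
        Finset.Ico (P - D) (P - D + N) by ext; simp; omega]
    simp
  · have h4 := shift_dvd (Q := (Q : ℤ)) (D := D) (by exact_mod_cast hD) (w := -u * P + Q) (by simp) hPw
      (hzd y hy)
    rw [← Nat.cast_mul P Q] at h4
    obtain ⟨e, he⟩ := dvd_add (h1 y hy) h4
    refine ⟨e, ?_⟩
    push_cast at he ⊢
    linear_combination he

/-! ### Choice of the exponents -/

theorem exists_exponents {p q r : ℕ} (hp : p.Prime) (hq : q.Prime) (hr : r.Prime)
    (hpq : p ≠ q) (hqr : q ≠ r) (hrp : r ≠ p) {s : ℤ} (hs : s * s = 1) (N : ℕ) :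
    ∃ a b c l μ D v : ℕ, 8 * l ≤ p ^ a ∧ μ * p ^ a + l * q ^ b = p ^ a * q ^ b + 1 ∧
      ((p ^ a : ℕ) * (q ^ b : ℕ) : ℤ) ∣ (s * v * (p ^ a : ℕ) + (q ^ b : ℕ)) * (r ^ c : ℕ) - 1 ∧
      p ^ a ∣ q ^ b + D ∧ 0 < D ∧ 2 * N ≤ D ∧ D + 8 * N ≤ p ^ a ∧ N ≤ l ∧
      q ^ b ≤ 4 * (v * p ^ a) ∧ 4 * (v * p ^ a) ≤ 3 * q ^ b ∧ 8 * p ^ a ≤ q ^ b ∧ 2 < p ^ a ∧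
      p ^ a * q ^ b + p ^ a + q ^ b ≤ r ^ c := by
  have cpq := (Nat.coprime_primes hp hq).2 hpq
  have cpr := (Nat.coprime_primes hp hr).2 hrp.symm
  have cqr := (Nat.coprime_primes hq hr).2 hqr
  obtain ⟨k₁, _, hk₁, -, H₁⟩ := exists_large_pow_modEq hp hr hrp.symm hq.one_lt cpq cqr.symm
  obtain ⟨k₂, l₂, hk₂, hl₂, H₂⟩ := exists_large_pow_modEq hp hq hpq hr.one_lt cpr cqr
  obtain ⟨k, hk⟩ : ∃ k, k = k₁ + k₂ + 8 * N + 10 := ⟨_, rfl⟩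
  have hTk : k < p ^ k := Nat.lt_pow_self hp.one_lt
  have hd1 : (p : ℤ) ^ k₁ ∣ (p : ℤ) ^ k := pow_dvd_pow _ (by omega)
  have hd2 : (p : ℤ) ^ k₂ ∣ (p : ℤ) ^ k := pow_dvd_pow _ (by omega)
  have hPT : p ^ (2 * k) = p ^ k * p ^ k := by rw [← pow_add]; congr 1; omega
  -- Only `q ^ b ≡ 1 - p ^ k` modulo `p ^ (2 * k)` matters; the modulus `r ^ 0` is void. The size of
  -- `b` leaves room for a full residue system modulo `q ^ l₂` among the admissible `v`.
  obtain ⟨b, hb, hQ, -⟩ := H₁ (2 * k) 0 (l₂ + 8 * p ^ (2 * k) * (1 + q ^ l₂)) (1 - (p : ℤ) ^ k) 1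
    (by rw [Int.modEq_comm, Int.modEq_iff_dvd]; simpa using hd1) rfl
  have hQb : b < q ^ b := Nat.lt_pow_self hq.one_lt
  have hqlb : (q : ℤ) ^ l₂ ∣ (q : ℤ) ^ b := pow_dvd_pow _ (by omega)
  have hcPQ : (p ^ (2 * k)).Coprime (q ^ b) := Nat.Coprime.pow _ _ cpq
  have hcPl : (p ^ (2 * k)).Coprime (q ^ l₂) := Nat.Coprime.pow _ _ cpq
  generalize hT : p ^ k = T at *
  have hT' : (p : ℤ) ^ k = T := by rw [← hT]; push_cast; rfl
  rw [hT'] at hQ hd2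
  generalize hP : p ^ (2 * k) = P at *
  have hP' : (p : ℤ) ^ (2 * k) = P := by rw [← hP]; push_cast; rfl
  have hq0 : 0 < q ^ l₂ := pow_pos hq.pos _
  have hP0 : 0 < P := hP ▸ pow_pos hp.pos _
  obtain ⟨i, j, hij⟩ := Nat.isCoprime_iff_coprime.2 hcPl
  -- With `s * v * P ≡ 1` modulo `q ^ l₂`, its inverse `z` modulo `q ^ b` is also `≡ 1` modulo `q ^
  -- l₂`, hence within reach of the powers of `r`.
  obtain ⟨v, hv, hv1, hv2⟩ := exists_modEq_mem_Ico hq0 (s * i) (q ^ b / (4 * P) + 1)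
  have hsv : s * v * P ≡ 1 [ZMOD (q : ℤ) ^ l₂] := by
    obtain ⟨d, hd⟩ := hv.dvd
    rw [Int.modEq_iff_dvd]
    push_cast at hd hij
    exact ⟨j + s * P * d, by linear_combination (-1 : ℤ) * hij + s * P * hd - i * P * hs⟩
  have hcop : IsCoprime (s * v * P) ((q : ℤ) ^ b) := by
    apply IsCoprime.pow_right
    obtain ⟨d, hd⟩ := hsv.dvd
    have e : (q : ℤ) ^ l₂ = q ^ (l₂ - 1) * q := by rw [← pow_succ, Nat.sub_add_cancel hl₂]
    rw [e] at hd
    exact ⟨1, q ^ (l₂ - 1) * d, by linear_combination -hd⟩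
  obtain ⟨z, z', hz⟩ := hcop
  have hz1 : z ≡ 1 [ZMOD (q : ℤ) ^ l₂] := by
    obtain ⟨d, hd⟩ := hsv.dvd
    obtain ⟨e, he⟩ := hqlb
    rw [Int.modEq_iff_dvd]
    exact ⟨z' * e - z * d, by linear_combination (-1 : ℤ) * hz - z * hd + z' * he⟩
  obtain ⟨c, hc, hRP, hRQ⟩ := H₂ (2 * k) b (P * q ^ b + P + q ^ b) (1 + T) z
    (by rw [Int.modEq_comm, Int.modEq_iff_dvd]; simpa using hd2) hz1
  rw [hP'] at hRP hQ
  obtain ⟨d₁, hd₁⟩ := hQ.dvd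
  obtain ⟨d₂, hd₂⟩ := hRP.dvd
  obtain ⟨d₃, hd₃⟩ := hRQ.dvd
  have hPTZ : (P : ℤ) = T * T := by exact_mod_cast hPT
  have hRc : c < r ^ c := Nat.lt_pow_self hr.one_lt
  have hQbig : 8 * P * (1 + q ^ l₂) ≤ q ^ b := by omega
  have h8P : 8 * P ≤ 8 * P * (1 + q ^ l₂) := Nat.le_mul_of_pos_right _ (by omega)
  have hT10 : 8 * N + 10 < T := by omega
  have hPbig : (8 * N + 10) * T ≤ P := hPT ▸ Nat.mul_le_mul_right _ hT10.le
  have hNT : 0 ≤ N * T := Nat.zero_le _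
  have e0 : (8 * N + 10) * T = 8 * (N * T) + 10 * T := by ring
  have hQZ : ((q ^ b : ℕ) : ℤ) = 1 - T - P * d₁ := by push_cast; linear_combination -hd₁
  have hlQ : (1 + T) * q ^ b ≤ P * q ^ b := Nat.mul_le_mul_right _ (by omega)
  have hdvdP : (P : ℤ) ∣ (s * v * P + (q ^ b : ℕ)) * (r ^ c : ℕ) - 1 := by
    refine ⟨s * v * r ^ c - 1 - (1 - T) * d₂ - d₁ * r ^ c, ?_⟩
    rw [hQZ]
    push_cast
    linear_combination (T - 1 : ℤ) * hd₂ + hPTZ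
  have hdvdQ : ((q ^ b : ℕ) : ℤ) ∣ (s * v * P + (q ^ b : ℕ)) * (r ^ c : ℕ) - 1 := by
    refine ⟨r ^ c - z' - s * v * P * d₃, ?_⟩
    push_cast
    linear_combination hz - s * v * P * hd₃
  have hμ : ∃ μ, μ * P + (1 + T) * q ^ b = P * q ^ b + 1 := by
    have h1 : (P : ℤ) ∣ ((P * q ^ b + 1 - (1 + T) * q ^ b : ℕ) : ℤ) := by
      rw [Nat.cast_sub (by omega)]
      refine ⟨q ^ b + 1 + (1 + T) * d₁, ?_⟩
      push_cast at hQZ ⊢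
      linear_combination -(1 + T : ℤ) * hQZ - hPTZ
    obtain ⟨μ, hμ⟩ := Int.natCast_dvd_natCast.1 h1
    exact ⟨μ, by rw [mul_comm μ, ← hμ]; omega⟩
  obtain ⟨μ, hμ⟩ := hμ
  -- Modulo `P = T ^ 2`, `Q ≡ 1 - T` has inverse `1 + T = l`, and `-Q ≡ T - 1 = D`.
  refine ⟨2 * k, b, c, 1 + T, μ, T - 1, v, ?_⟩
  rw [hP]
  refine ⟨by omega, hμ, ?_, ?_, by omega, by omega, by omega, by omega, ?_, ?_, by omega,
    by omega, by omega⟩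
  · exact (Nat.isCoprime_iff_coprime.2 hcPQ).mul_dvd hdvdP hdvdQ
  · rw [← Int.natCast_dvd_natCast]
    refine ⟨-d₁, ?_⟩
    rw [Nat.cast_add, hQZ, Nat.cast_sub (by omega)]
    push_cast
    ring
  · have h1 : (q ^ b / (4 * P) + 1) * (4 * P) ≤ v * (4 * P) := Nat.mul_le_mul_right _ hv1
    have h2 := Nat.lt_div_mul_add (a := q ^ b) (b := 4 * P) (by omega)
    have e1 : (q ^ b / (4 * P) + 1) * (4 * P) = q ^ b / (4 * P) * (4 * P) + 4 * P := by ring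
    have e2 : v * (4 * P) = 4 * (v * P) := by ring
    omega
  · have h1 : v * (4 * P) ≤ (q ^ b / (4 * P) + (1 + q ^ l₂)) * (4 * P) :=
      Nat.mul_le_mul_right _ (by omega)
    have h2 := Nat.div_mul_le_self (q ^ b) (4 * P)
    have e1 : (q ^ b / (4 * P) + (1 + q ^ l₂)) * (4 * P) =
      q ^ b / (4 * P) * (4 * P) + 4 * (P * (1 + q ^ l₂)) := by ring
    have e2 : v * (4 * P) = 4 * (v * P) := by ring
    have e3 : 8 * P * (1 + q ^ l₂) = 8 * (P * (1 + q ^ l₂)) := by ring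
    omega

/-! ### All integers occur -/

theorem mem_coeffSet_of_coeff_ne_zero {f : ℤ[X]} {m : ℕ} (h : f.coeff m ≠ 0) :
    f.coeff m ∈ coeffSet f :=
  ⟨m, le_natDegree_of_ne_zero h, rfl⟩

theorem exists_mem_coeffSet_unitaryCyclotomic {p q r : ℕ} (hp : p.Prime) (hq : q.Prime)
    (hr : r.Prime) (hpq : p ≠ q) (hqr : q ≠ r) (hrp : r ≠ p) (n : ℤ) :
    ∃ a b c : ℕ, (2 < p ^ a ∧ 2 < q ^ b ∧ 2 < r ^ c) ∧
      n ∈ coeffSet (unitaryCyclotomic p q r a b c) := by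
  have cop : ∀ a b c : ℕ, (p ^ a).Coprime (q ^ b) ∧ (q ^ b).Coprime (r ^ c) ∧
      (r ^ c).Coprime (p ^ a) := fun a b c =>
    ⟨((Nat.coprime_primes hp hq).2 hpq).pow _ _, ((Nat.coprime_primes hq hr).2 hqr).pow _ _,
      ((Nat.coprime_primes hr hp).2 hrp).pow _ _⟩
  rcases lt_or_ge n 0 with hn | hn
  · obtain ⟨N, rfl⟩ : ∃ N : ℕ, n = -N := ⟨n.natAbs, by omega⟩
    obtain ⟨a, b, c, l, μ, D, v, hl, hμ, hd, hD, hD0, hND, hDP, hNl, hv, hv', h8, h2, hR⟩ :=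
      exists_exponents hp hq hr hpq hqr hrp (s := -1) (by norm_num) N
    obtain ⟨h1, h2', h3⟩ := cop a b c
    rw [neg_one_mul] at hd
    obtain ⟨m, hm⟩ := exists_coeff_eq_neg_natCast h1 h2' h3 hl hμ hd hD hD0 hND hDP hNl hv hv' h8
      h2.le hR
    refine ⟨a, b, c, ⟨h2, by omega, by omega⟩, ?_⟩
    rw [← hm]
    exact mem_coeffSet_of_coeff_ne_zero (hm.trans_ne hn.ne)
  · obtain ⟨N, rfl⟩ := Int.eq_ofNat_of_zero_le hn
    obtain ⟨a, b, c, l, μ, D, v, hl, hμ, hd, hD, hD0, hND, hDP, hNl, hv, hv', h8, h2, hR⟩ :=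
      -- Exponents good for `N + 1` also serve `N`. The nonzero coefficient `N + 1` sits at a higher
      -- index, so the index of `N` is within the degree even when `N = 0`.
      exists_exponents hp hq hr hpq hqr hrp (s := 1) (by norm_num) (N + 1)
    obtain ⟨h1, h2', h3⟩ := cop a b c
    rw [one_mul] at hd
    obtain ⟨m, -, hlt, hm⟩ := exists_coeff_eq_natCast (N := N) h1 h2' h3 hl hμ hd hD hD0 (by omega)
      (by omega) (by omega) hv hv' h8 h2.le hR
    obtain ⟨m', hle, -, hm'⟩ := exists_coeff_eq_natCast h1 h2' h3 hl hμ hd hD hD0 hND hDP hNl hv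
      hv' h8 h2.le hR
    refine ⟨a, b, c, ⟨h2, by omega, by omega⟩, m, ?_, hm⟩
    have hmm : m < m' := by
      refine hlt.trans_le (le_trans (Nat.mul_le_mul_left _ ?_) hle)
      rw [Nat.succ_mul]
      omega
    exact hmm.le.trans (le_natDegree_of_ne_zero (hm'.trans_ne (by positivity)))

theorem mainTheorem2 (p q r : ℕ) (hp : p.Prime) (hq : q.Prime) (hr : r.Prime)
    (hpq : p ≠ q) (hqr : q ≠ r) (hrp : r ≠ p) :
    (⋃ (a : ℕ) (b : ℕ) (c : ℕ) (_ : 2 < p ^ a ∧ 2 < q ^ b ∧ 2 < r ^ c),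
        coeffSet (unitaryCyclotomic p q r a b c)) = Set.univ ∧
    ∀ M : ℕ, ∃ a b c : ℕ, 2 < p ^ a ∧ 2 < q ^ b ∧ 2 < r ^ c ∧
      ∃ n ∈ coeffSet (unitaryCyclotomic p q r a b c), (M : ℤ) < |n| := by
  have key := fun n : ℤ => exists_mem_coeffSet_unitaryCyclotomic hp hq hr hpq hqr hrp n
  constructor
  · refine Set.eq_univ_of_forall fun n => ?_
    obtain ⟨a, b, c, h, hn⟩ := key n
    simp only [Set.mem_iUnion]
    exact ⟨a, b, c, h, hn⟩
  · intro M
    obtain ⟨a, b, c, ⟨h1, h2, h3⟩, hn⟩ := key (M + 1)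
    exact ⟨a, b, c, h1, h2, h3, _, hn, by rw [abs_of_nonneg (by positivity)]; omega⟩
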